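/- Let $A$ be a finite set, let $F_A$ be the free group on $A$, let $G$ be a group, and let $\varphi\colon F_A\to G$ be a surjective homomorphism. Let $\vec T_A$ be the oriented Cayley graph of $F_A$ with respect to $A$: its vertex set is $F_A$ and for all $g\in F_A$, $a\in A$ there is one edge from $g$ to $ga$. The group $F_A$, and hence $\ker\varphi$, acts on $\vec T_A$ by left multiplication. Let $X=\ker(\varphi)\backslash\vec T_A$ be the quotient, a directed graph that may have loops and multiple edges, and whose vertex set is identified with $G$; automorphisms of $X$ are automorphisms of directed multigraphs, acting on vertices and on edges. The group $G=F_A/\ker\varphi$ is viewed as a subgroup of $\mathrm{Aut}(X)$ through left multiplication. Let $\mathrm{Aut}_1(X)$ be the stabiliser in $\mathrm{Aut}(X)$ of the vertex corresponding to $1\in G$, and let $$\mathrm{Comm}_{\mathrm{Aut}(X)}(G)=\{f\in\mathrm{Aut}(X) : [G:G\cap fGf^{-1}]<\infty,\ [fGf^{-1}:G\cap fGf^{-1}]<\infty\}.$$ A bireversible automaton over $A$ is a tuple $\mathcal M=(A,Q,\lambda,\rho)$ with $Q$ a finite set and maps $\lambda\colon Q\times A\to A$, $\rho\colon Q\times A\to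 Q$ such that $\lambda(q,\cdot)\colon A\to A$ is bijective for all $q\in Q$, $\rho(\cdot,a)\colon Q\to Q$ is bijective for all $a\in A$, and $(q,a)\mapsto(\lambda(q,a),\rho(q,a))$ is a bijection $Q\times A\to A\times Q$. Put $$\pi_1(\mathcal M)=\langle Q,A \mid qa=\lambda(q,a)\rho(q,a)\ \ \forall q\in Q,\ a\in A\rangle .$$ The subgroups of $\pi_1(\mathcal M)$ generated by $Q$ and $A$ are free on $Q$ and $A$ and are denoted by $F_Q$ and $F_A$; every element of $\pi_1(\mathcal M)$ can be written uniquely as $wh$ with $w\in F_A$, $h\in F_Q$. The group $\pi_1(\mathcal M)$ acts on $\vec T_A$ by automorphisms, where $g\in\pi_1(\mathcal M)$ maps the vertex $v\in F_A$ to the unique $w\in F_A$ with $gv\in wF_Q$. Let $N_Q$ be the largest normal subgroup of $\pi_1(\mathcal M)$ contained in $F_Q$; it acts trivially, so the action induces a homomorphism $\psi_{\mathcal M}\colon\pi_1(\mathcal M)/N_Q\to\mathrm{Aut}(\vec T_A)$. The group generated by $\mathcal M$ is $G_{\mathcal M}=F_Q/N_Q\le\pi_1(\mathcal M)/N_Q$.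 The automaton $\mathcal M$ is compatible with $\varphi$ if the image of $\ker\varphi\le F_A$ in $\pi_1(\mathcal M)/N_Q$ is a normal subgroup of $\pi_1(\mathcal M)/N_Q$. Let $\zeta_\varphi$ be the homomorphism from the normaliser of $\ker\varphi$ in $\mathrm{Aut}(\vec T_A)$ to $\mathrm{Aut}(X)$ that sends an automorphism to the one it induces on $X$. An automorphism $f\in\mathrm{Aut}_1(X)$ is called bireversible if there is a bireversible automaton $\mathcal M$ over $A$ that is compatible with $\varphi$ and such that $f\in\zeta_\varphi(\psi_{\mathcal M}(G_{\mathcal M}))$. Then an automorphism of $X$ lies in $\mathrm{Comm}_{\mathrm{Aut}(X)}(G)\cap\mathrm{Aut}_1(X)$ if and only if it is a bireversible automorphism of $X$; that is, $$\mathrm{Comm}_{\mathrm{Aut}(X)}(G)\cap\mathrm{Aut}_1(X)=B_X,$$ where $B_X$ is the set of bireversible automorphisms of $X$. -/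

import Mathlib

universe u v w

/-! ### Directed multigraphs, their automorphisms and their quotients -/

/-- A directed multigraph (loops and multiple edges allowed) with vertex set `V` and edge set `E`. -/
structure DirectedMultigraph (V : Type u) (E : Type v) where
  /-- The origin of an edge. -/
  src : E → V
  /-- The end of an edge. -/
  tgt : E → V

namespace DirectedMultigraph

variable {V : Type u} {E : Type v}

/-- The automorphism group of a directed multigraph: pairs consisting of a permutation of the
vertices and a permutation of the edges, compatible with origins and ends. -/
def aut (Γ : DirectedMultigraph V E) : Subgroup (Equiv.Perm V × Equiv.Perm E) where
  carrier := {f | ∀ e, Γ.src (f.2 e) = f.1 (Γ.src e) ∧ Γ.tgt (f.2 e) = f.1 (Γ.tgt e)}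
  mul_mem' := by
    intro f g hf hg e
    simp [hf (g.2 e), hg e]
  one_mem' := by
    intro e
    simp
  inv_mem' := by
    intro f hf e
    have h := hf (f.2⁻¹ e)
    have he : f.2 (f.2⁻¹ e) = e := f.2.apply_symm_apply e
    rw [he] at h
    exact ⟨f.1.injective (h.1.symm.trans (f.1.apply_symm_apply _).symm),
      f.1.injective (h.2.symm.trans (f.1.apply_symm_apply _).symm)⟩

/-- The action of the automorphism group on the vertices. -/
instance vertexAction (Γ : DirectedMultigraph V E) : MulAction Γ.aut V where
  smul f x := f.1.1 x
  one_smul _ := rfl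
  mul_smul _ _ _ := rfl

/-- The action of the automorphism group on the edges. -/
instance edgeAction (Γ : DirectedMultigraph V E) : MulAction Γ.aut E where
  smul f e := f.1.2 e
  one_smul _ := rfl
  mul_smul _ _ _ := rfl

variable (Γ : DirectedMultigraph V E)

theorem src_smul (f : Γ.aut) (e : E) : Γ.src (f • e) = f • Γ.src e := (f.2 e).1

theorem tgt_smul (f : Γ.aut) (e : E) : Γ.tgt (f • e) = f • Γ.tgt e := (f.2 e).2

/-- Construct an automorphism from its actions on vertices and edges. -/
def mkAut (f : Equiv.Perm V) (g : Equiv.Perm E)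
    (h : ∀ e, Γ.src (g e) = f (Γ.src e) ∧ Γ.tgt (g e) = f (Γ.tgt e)) : Γ.aut :=
  ⟨(f, g), h⟩

theorem aut_ext {f g : Γ.aut} (hV : ∀ x : V, f • x = g • x) (hE : ∀ e : E, f • e = g • e) :
    f = g :=
  Subtype.ext (Prod.ext (Equiv.ext hV) (Equiv.ext hE))

/-- The quotient graph `K \ Γ` of `Γ` by a group `K` of automorphisms: its vertices (edges) are the
`K`-orbits of vertices (edges) of `Γ`. -/
def quotient (K : Subgroup Γ.aut) :
    DirectedMultigraph (MulAction.orbitRel.Quotient K V) (MulAction.orbitRel.Quotient K E) where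
  src := Quotient.map Γ.src (by
    rintro e e' ⟨k, hk⟩
    exact ⟨k, by rw [← hk]; exact (Γ.src_smul k e').symm⟩)
  tgt := Quotient.map Γ.tgt (by
    rintro e e' ⟨k, hk⟩
    exact ⟨k, by rw [← hk]; exact (Γ.tgt_smul k e').symm⟩)

/-- An element normalising `K` maps `K`-orbits to `K`-orbits. -/
theorem orbitRel_smul_iff {N : Type*} [Group N] {S : Type*} [MulAction N S] (K : Subgroup N)
    (f : N) (hf : f ∈ Subgroup.normalizer (K : Set N)) (x y : S) :
    MulAction.orbitRel K S x y ↔ MulAction.orbitRel K S (f • x) (f • y) := by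
  constructor
  · rintro ⟨k, rfl⟩
    refine ⟨⟨f * k * f⁻¹, (Subgroup.mem_normalizer_iff.1 hf k).1 k.2⟩, ?_⟩
    change (f * k * f⁻¹) • f • y = f • (k : N) • y
    simp [mul_smul]
  · rintro ⟨k, hk⟩
    refine ⟨⟨f⁻¹ * k * f, (Subgroup.mem_normalizer_iff''.1 hf k).1 k.2⟩, ?_⟩
    change (k : N) • f • y = f • x at hk
    change (f⁻¹ * k * f) • y = x
    simp [mul_smul, hk]

/-- The homomorphism `ζ` from the normaliser of `K` in `Aut Γ` to `Aut (K \ Γ)`, sending an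
automorphism to the one that it induces on the quotient. -/
def descend (K : Subgroup Γ.aut) :
    Subgroup.normalizer (K : Set Γ.aut) →* (Γ.quotient K).aut where
  toFun f := (Γ.quotient K).mkAut
    (Quotient.congr f.1.1.1 (fun x y => orbitRel_smul_iff K f.1 f.2 x y))
    (Quotient.congr f.1.1.2 (fun x y => orbitRel_smul_iff K f.1 f.2 x y))
    (by
      intro e
      induction e using Quotient.inductionOn with
      | _ e => exact ⟨congrArg _ (Γ.src_smul f.1 e), congrArg _ (Γ.tgt_smul f.1 e)⟩)
  map_one' := by
    apply aut_ext
    · intro x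
      induction x using Quotient.inductionOn with
      | _ x => rfl
    · intro x
      induction x using Quotient.inductionOn with
      | _ x => rfl
  map_mul' f g := by
    apply aut_ext
    · intro x
      induction x using Quotient.inductionOn with
      | _ x => rfl
    · intro x
      induction x using Quotient.inductionOn with
      | _ x => rfl

/-- `ζ f` is compatible with `f` and the projection, on vertices. -/
theorem descend_smul_vertex (K : Subgroup Γ.aut) (f : Subgroup.normalizer (K : Set Γ.aut)) (x : V) :
    Γ.descend K f • (Quotient.mk _ x : MulAction.orbitRel.Quotient K V) =
      Quotient.mk _ (f.1 • x) := rfl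

/-- `ζ f` is compatible with `f` and the projection, on edges. -/
theorem descend_smul_edge (K : Subgroup Γ.aut) (f : Subgroup.normalizer (K : Set Γ.aut)) (e : E) :
    Γ.descend K f • (Quotient.mk _ e : MulAction.orbitRel.Quotient K E) =
      Quotient.mk _ (f.1 • e) := rfl

end DirectedMultigraph

/-! ### The oriented Cayley graph of a free group -/

/-- The oriented Cayley graph `T_A` of the free group `F_A` with respect to `A`: its vertex set is
`F_A` and there is one edge `(g, a)` from `g` to `g * a` for all `g ∈ F_A` and `a ∈ A`. -/
def freeTree (A : Type u) : DirectedMultigraph (FreeGroup A) (FreeGroup A × A) where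
  src e := e.1
  tgt e := e.1 * FreeGroup.of e.2

/-- The action of `F_A` on `T_A` by left multiplication. -/
def leftMul (A : Type u) : FreeGroup A →* (freeTree A).aut where
  toFun g := (freeTree A).mkAut (Equiv.mulLeft g) (Equiv.prodCongr (Equiv.mulLeft g) (Equiv.refl A))
    (fun e => ⟨rfl, mul_assoc g e.1 (FreeGroup.of e.2)⟩)
  map_one' := DirectedMultigraph.aut_ext _ (fun x => one_mul x)
    (fun e => Prod.ext (one_mul e.1) rfl)
  map_mul' g h := DirectedMultigraph.aut_ext _ (fun x => mul_assoc g h x)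
    (fun e => Prod.ext (mul_assoc g h e.1) rfl)

/-- An automorphism of `T_A` that fixes every vertex is trivial. -/
theorem freeTree_aut_eq_one {A : Type u} (f : (freeTree A).aut)
    (h : ∀ x : FreeGroup A, f • x = x) : f = 1 := by
  refine DirectedMultigraph.aut_ext _ (fun x => by rw [h, one_smul]) (fun e => ?_)
  rw [one_smul]
  have h1 : (f • e).1 = e.1 := ((freeTree A).src_smul f e).trans (h _)
  have h2 : (f • e).1 * FreeGroup.of (f • e).2 = e.1 * FreeGroup.of e.2 :=
    ((freeTree A).tgt_smul f e).trans (h _)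
  rw [h1] at h2
  exact Prod.ext h1 (FreeGroup.of_injective (mul_left_cancel h2))

/-! ### Mealy automata -/

/-- A Mealy automaton with alphabet `A` and state set `Q` (finiteness of `A` and `Q` is imposed
where automata are used). -/
structure MealyAutomaton (A : Type u) (Q : Type v) where
  /-- The output map `λ : Q × A → A`. -/
  out : Q → A → A
  /-- The transition map `ρ : Q × A → Q`. -/
  next : Q → A → Q

namespace MealyAutomaton

variable {A : Type u} {Q : Type v}

/-- Every state induces a bijection of the alphabet. -/
def Invertible (M : MealyAutomaton A Q) : Prop :=
  ∀ q, Function.Bijective (M.out q)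

/-- Every letter induces a bijection of the state set. -/
def Reversible (M : MealyAutomaton A Q) : Prop :=
  ∀ a, Function.Bijective (fun q => M.next q a)

/-- Bireversible automata. -/
def Bireversible (M : MealyAutomaton A Q) : Prop :=
  M.Invertible ∧ M.Reversible ∧
    Function.Bijective (fun x : Q × A => (M.out x.1 x.2, M.next x.1 x.2))

/-- The relators of the fundamental group. -/
def relators (M : MealyAutomaton A Q) : Set (FreeGroup (Q ⊕ A)) :=
  Set.range fun x : Q × A =>
    FreeGroup.of (Sum.inl x.1) * FreeGroup.of (Sum.inr x.2) *
      (FreeGroup.of (Sum.inr (M.out x.1 x.2)) * FreeGroup.of (Sum.inl (M.next x.1 x.2)))⁻¹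

/-- The fundamental group `π₁(M) = ⟨Q, A | q a = λ(q,a) ρ(q,a)⟩`. -/
abbrev FundamentalGroup (M : MealyAutomaton A Q) : Type (max u v) :=
  PresentedGroup M.relators

/-- The canonical homomorphism `F_A → π₁(M)`. -/
def letters (M : MealyAutomaton A Q) : FreeGroup A →* M.FundamentalGroup :=
  FreeGroup.lift fun a => PresentedGroup.of (Sum.inr a)

/-- The canonical homomorphism `F_Q → π₁(M)`. -/
def states (M : MealyAutomaton A Q) : FreeGroup Q →* M.FundamentalGroup :=
  FreeGroup.lift fun q => PresentedGroup.of (Sum.inl q)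

/-- `N_Q`, the largest normal subgroup of `π₁(M)` that is contained in (the image of) `F_Q`. -/
def stateKernel (M : MealyAutomaton A Q) : Subgroup M.FundamentalGroup :=
  M.states.range.normalCore

instance (M : MealyAutomaton A Q) : M.stateKernel.Normal :=
  Subgroup.normalCore_normal _

/-- The group `G_M` generated by a bireversible automaton `M`, as the subgroup `F_Q / N_Q` of
`π₁(M) / N_Q`. -/
def automatonGroup (M : MealyAutomaton A Q) : Subgroup (M.FundamentalGroup ⧸ M.stateKernel) :=
  M.states.range.map (QuotientGroup.mk' M.stateKernel)

/-! #### The action of the fundamental group on the tree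

A state `q` acts on `F_A` by the extension of `λ_q` to all group words, with
`λ_q(v a) = λ_q(v) λ(ρ_v(q), a)`. -/

/-- The action of words in `A` on `Q × F_A` from the right: the letter `a` maps `(q, w)` to
`(ρ(q,a), w λ(q,a))`. -/
noncomputable def run (M : MealyAutomaton A Q) (hM : M.Reversible) :
    FreeGroup A →* (Equiv.Perm (Q × FreeGroup A))ᵐᵒᵖ :=
  FreeGroup.lift fun a => MulOpposite.op <|
    Equiv.prodShear (Equiv.ofBijective _ (hM a)) fun q => Equiv.mulRight (FreeGroup.of (M.out q a))

/-- The state reached from `q` after reading the group word `v`. -/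
noncomputable def nextWord (M : MealyAutomaton A Q) (hM : M.Reversible) (q : Q) (v : FreeGroup A) :
    Q :=
  ((M.run hM v).unop (q, 1)).1

/-- The output when the group word `v` is read from the state `q`. -/
noncomputable def outWord (M : MealyAutomaton A Q) (hM : M.Reversible) (q : Q) (v : FreeGroup A) :
    FreeGroup A :=
  ((M.run hM v).unop (q, 1)).2

section words

variable (M : MealyAutomaton A Q) (hM : M.Reversible)

theorem run_mul_left (v x w : FreeGroup A) (q : Q) :
    (M.run hM v).unop (q, x * w) =
      (((M.run hM v).unop (q, w)).1, x * ((M.run hM v).unop (q, w)).2) := by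
  have hof : ∀ (a : A) (q : Q) (w : FreeGroup A), (M.run hM (FreeGroup.of a)).unop (q, w) =
      (M.next q a, w * FreeGroup.of (M.out q a)) := by
    intro a q w
    simp [run]
  induction v using FreeGroup.induction_on generalizing q w with
  | C1 => simp
  | of a => simp [hof, mul_assoc]
  | inv_of a ih =>
    rw [map_inv, MulOpposite.unop_inv, Equiv.Perm.inv_eq_iff_eq, ← Prod.mk.eta
      (p := ((M.run hM (FreeGroup.of a)).unop⁻¹ (q, w))), ih]
    simp
  | mul v u hv hu =>
    simp only [map_mul, MulOpposite.unop_mul, Equiv.Perm.mul_apply]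
    rw [hv, hu]

theorem run_apply (v w : FreeGroup A) (q : Q) :
    (M.run hM v).unop (q, w) = (M.nextWord hM q v, w * M.outWord hM q v) := by
  simpa [nextWord, outWord] using M.run_mul_left hM v w 1 q

@[simp] theorem nextWord_of (q : Q) (a : A) :
    M.nextWord hM q (FreeGroup.of a) = M.next q a := by
  simp [nextWord, run]

@[simp] theorem outWord_of (q : Q) (a : A) :
    M.outWord hM q (FreeGroup.of a) = FreeGroup.of (M.out q a) := by
  simp [outWord, run]

@[simp] theorem nextWord_one (q : Q) : M.nextWord hM q 1 = q := by
  simp [nextWord]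

@[simp] theorem outWord_one (q : Q) : M.outWord hM q 1 = 1 := by
  simp [outWord]

theorem nextWord_mul (q : Q) (v u : FreeGroup A) :
    M.nextWord hM q (v * u) = M.nextWord hM (M.nextWord hM q v) u := by
  have h := M.run_apply hM u (M.outWord hM q v) (M.nextWord hM q v)
  rw [nextWord, map_mul, MulOpposite.unop_mul, Equiv.Perm.mul_apply, M.run_apply hM v, one_mul, h]

theorem outWord_mul (q : Q) (v u : FreeGroup A) :
    M.outWord hM q (v * u) = M.outWord hM q v * M.outWord hM (M.nextWord hM q v) u := by
  have h := M.run_apply hM u (M.outWord hM q v) (M.nextWord hM q v)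
  rw [outWord, map_mul, MulOpposite.unop_mul, Equiv.Perm.mul_apply, M.run_apply hM v, one_mul, h]

/-- The extension to group words of mutually inverse automata. -/
theorem words_inverse (N : MealyAutomaton A Q) (hN : N.Reversible)
    (h1 : ∀ q a, N.out q (M.out q a) = a) (h2 : ∀ q a, N.next q (M.out q a) = M.next q a)
    (v : FreeGroup A) : ∀ q, N.outWord hN q (M.outWord hM q v) = v ∧
      N.nextWord hN q (M.outWord hM q v) = M.nextWord hM q v := by
  induction v using FreeGroup.induction_on with
  | C1 => simp
  | of a => simp [h1, h2]
  | inv_of a ih =>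
    intro q
    set x : FreeGroup A := FreeGroup.of a
    set r := M.nextWord hM q x⁻¹ with hr
    have hrx : M.nextWord hM r x = q := by
      rw [hr, ← nextWord_mul, inv_mul_cancel, nextWord_one]
    have ho : M.outWord hM q x⁻¹ = (M.outWord hM r x)⁻¹ := by
      rw [eq_inv_iff_mul_eq_one, hr, ← outWord_mul, inv_mul_cancel, outWord_one]
    obtain ⟨i1, i2⟩ := ih r
    have hn : N.nextWord hN q (M.outWord hM r x)⁻¹ = r := by
      rw [← hrx, ← i2, ← nextWord_mul, mul_inv_cancel, nextWord_one]
    refine ⟨?_, by rw [ho, hn]⟩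
    have h := N.outWord_mul hN q (M.outWord hM r x)⁻¹ (M.outWord hM r x)
    rw [inv_mul_cancel, outWord_one, hn, i1] at h
    rw [ho, eq_inv_iff_mul_eq_one, ← h]
  | mul v u hv hu =>
    intro q
    simp only [outWord_mul, nextWord_mul]
    rw [(hv q).1, (hv q).2, (hu _).1, (hu _).2]
    exact ⟨rfl, rfl⟩

end words

/-- The inverse automaton: `q` reads `λ(q,a)`, outputs `a` and moves to `ρ(q,a)`. -/
noncomputable def inverse (M : MealyAutomaton A Q) (hM : M.Invertible) : MealyAutomaton A Q where
  out q b := (Equiv.ofBijective _ (hM q)).symm b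
  next q b := M.next q ((Equiv.ofBijective _ (hM q)).symm b)

theorem inverse_reversible (M : MealyAutomaton A Q) (hM : M.Bireversible) :
    (M.inverse hM.1).Reversible := by
  intro b
  constructor
  · intro q q' h
    have e : ∀ p, M.out p ((Equiv.ofBijective _ (hM.1 p)).symm b) = b :=
      fun p => (Equiv.ofBijective _ (hM.1 p)).apply_symm_apply b
    have := @hM.2.2.1 (q, (Equiv.ofBijective _ (hM.1 q)).symm b)
      (q', (Equiv.ofBijective _ (hM.1 q')).symm b) (Prod.ext ((e q).trans (e q').symm) h)
    exact congrArg Prod.fst this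
  · intro r
    obtain ⟨⟨q, a⟩, h⟩ := hM.2.2.2 (b, r)
    refine ⟨q, ?_⟩
    have h1 : M.out q a = b := congrArg Prod.fst h
    have h2 : M.next q a = r := congrArg Prod.snd h
    have h3 : (Equiv.ofBijective _ (hM.1 q)).symm b = a :=
      (Equiv.ofBijective _ (hM.1 q)).symm_apply_eq.2 h1.symm
    change M.next q ((Equiv.ofBijective _ (hM.1 q)).symm b) = r
    rw [h3, h2]

section action

variable (M : MealyAutomaton A Q) (hM : M.Bireversible)

theorem inverse_words (q : Q) (v : FreeGroup A) :
    (M.inverse hM.1).outWord (M.inverse_reversible hM) q (M.outWord hM.2.1 q v) = v ∧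
      (M.inverse hM.1).nextWord (M.inverse_reversible hM) q (M.outWord hM.2.1 q v) =
        M.nextWord hM.2.1 q v := by
  refine words_inverse _ _ _ _ (fun q a => ?_) (fun q a => ?_) v q
  · exact (Equiv.ofBijective _ (hM.1 q)).symm_apply_apply a
  · exact congrArg (M.next q) ((Equiv.ofBijective _ (hM.1 q)).symm_apply_apply a)

theorem words_inverse_words (q : Q) (v : FreeGroup A) :
    M.outWord hM.2.1 q ((M.inverse hM.1).outWord (M.inverse_reversible hM) q v) = v ∧
      M.nextWord hM.2.1 q ((M.inverse hM.1).outWord (M.inverse_reversible hM) q v) =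
        (M.inverse hM.1).nextWord (M.inverse_reversible hM) q v := by
  refine words_inverse _ _ _ _ (fun q a => ?_) (fun q a => rfl) v q
  exact (Equiv.ofBijective _ (hM.1 q)).apply_symm_apply a

/-- The automorphism of `T_A` defined by a state `q`: it maps the vertex `v` to `λ_q(v)`. -/
noncomputable def stateAut (q : Q) : (freeTree A).aut :=
  (freeTree A).mkAut
    { toFun := M.outWord hM.2.1 q
      invFun := (M.inverse hM.1).outWord (M.inverse_reversible hM) q
      left_inv := fun v => (M.inverse_words hM q v).1
      right_inv := fun v => (M.words_inverse_words hM q v).1 }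
    { toFun := fun e => (M.outWord hM.2.1 q e.1, M.out (M.nextWord hM.2.1 q e.1) e.2)
      invFun := fun e => ((M.inverse hM.1).outWord (M.inverse_reversible hM) q e.1,
        (M.inverse hM.1).out ((M.inverse hM.1).nextWord (M.inverse_reversible hM) q e.1) e.2)
      left_inv := fun e => by
        have h := M.inverse_words hM q e.1
        refine Prod.ext h.1 ?_
        dsimp only
        rw [h.2]
        exact (Equiv.ofBijective _ (hM.1 _)).symm_apply_apply e.2
      right_inv := fun e => by
        have h := M.words_inverse_words hM q e.1
        refine Prod.ext h.1 ?_
        dsimp only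
        rw [h.2]
        exact (Equiv.ofBijective _ (hM.1 _)).apply_symm_apply e.2 }
    (fun e => ⟨rfl, by
      change M.outWord hM.2.1 q e.1 * FreeGroup.of (M.out (M.nextWord hM.2.1 q e.1) e.2) =
        M.outWord hM.2.1 q (e.1 * FreeGroup.of e.2)
      rw [outWord_mul, outWord_of]⟩)

theorem stateAut_relation (q : Q) (a : A) :
    M.stateAut hM q * leftMul A (FreeGroup.of a) =
      leftMul A (FreeGroup.of (M.out q a)) * M.stateAut hM (M.next q a) := by
  refine DirectedMultigraph.aut_ext _ (fun v => ?_) (fun e => ?_)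
  · change M.outWord hM.2.1 q (FreeGroup.of a * v) =
      FreeGroup.of (M.out q a) * M.outWord hM.2.1 (M.next q a) v
    rw [outWord_mul, outWord_of, nextWord_of]
  · change (M.outWord hM.2.1 q (FreeGroup.of a * e.1),
        M.out (M.nextWord hM.2.1 q (FreeGroup.of a * e.1)) e.2) =
      (FreeGroup.of (M.out q a) * M.outWord hM.2.1 (M.next q a) e.1,
        M.out (M.nextWord hM.2.1 (M.next q a) e.1) e.2)
    rw [outWord_mul, nextWord_mul, outWord_of, nextWord_of]

/-- The homomorphism `Ψ_M : π₁(M) → Aut(T_A)`: letters act by left multiplication and states by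
`stateAut`. It is the action with `g · v = w` whenever `g v = w h` in `π₁(M)` with `w ∈ F_A` and
`h ∈ F_Q`, see `fundamentalAction_spec`. -/
noncomputable def fundamentalAction : M.FundamentalGroup →* (freeTree A).aut :=
  PresentedGroup.toGroup (f := Sum.elim (M.stateAut hM) (fun a => leftMul A (FreeGroup.of a)))
    (by
      rintro _ ⟨⟨q, a⟩, rfl⟩
      simp only [map_mul, map_inv, FreeGroup.lift_apply_of, Sum.elim_inl, Sum.elim_inr]
      rw [mul_inv_eq_one]
      exact M.stateAut_relation hM q a)

theorem fundamentalAction_letters (v : FreeGroup A) :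
    M.fundamentalAction hM (M.letters v) = leftMul A v := by
  have : (M.fundamentalAction hM).comp M.letters = leftMul A := by
    ext1 a
    simp [fundamentalAction, letters]
  exact DFunLike.congr_fun this v

theorem states_mul_letters (q : Q) (v : FreeGroup A) :
    M.states (FreeGroup.of q) * M.letters v =
      M.letters (M.outWord hM.2.1 q v) * M.states (FreeGroup.of (M.nextWord hM.2.1 q v)) := by
  induction v using FreeGroup.induction_on generalizing q with
  | C1 => simp
  | of a =>
    have h : PresentedGroup.mk M.relators (FreeGroup.of (Sum.inl q) * FreeGroup.of (Sum.inr a) *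
        (FreeGroup.of (Sum.inr (M.out q a)) * FreeGroup.of (Sum.inl (M.next q a)))⁻¹) = 1 :=
      (QuotientGroup.eq_one_iff _).2 (Subgroup.subset_normalClosure ⟨(q, a), rfl⟩)
    rw [map_mul, map_inv, mul_inv_eq_one, map_mul, map_mul] at h
    rw [outWord_of, nextWord_of]
    simp only [letters, states, FreeGroup.lift_apply_of]
    exact h
  | inv_of a ih =>
    set x : FreeGroup A := FreeGroup.of a
    set r := M.nextWord hM.2.1 q x⁻¹ with hr
    have hrx : M.nextWord hM.2.1 r x = q := by
      rw [hr, ← nextWord_mul, inv_mul_cancel, nextWord_one]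
    have ho : M.outWord hM.2.1 q x⁻¹ = (M.outWord hM.2.1 r x)⁻¹ := by
      rw [eq_inv_iff_mul_eq_one, hr, ← outWord_mul, inv_mul_cancel, outWord_one]
    have h := ih r
    rw [hrx] at h
    rw [ho, map_inv, map_inv, mul_inv_eq_iff_eq_mul, mul_assoc, h, inv_mul_cancel_left]
  | mul v u hv hu =>
    rw [map_mul, ← mul_assoc, hv, mul_assoc, hu, outWord_mul, nextWord_mul, map_mul, mul_assoc]

/-- `Ψ_M(g)` maps `v` to the element `w` of `F_A` such that `g v = w h` with `h ∈ F_Q`. -/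
theorem fundamentalAction_spec (g : M.FundamentalGroup) (v : FreeGroup A) :
    ∃ h ∈ M.states.range, g * M.letters v = M.letters (M.fundamentalAction hM g • v) * h := by
  have hg : g ∈ Subgroup.closure (Set.range (PresentedGroup.of (rels := M.relators))) := by
    rw [PresentedGroup.closure_range_of]; trivial
  induction hg using Subgroup.closure_induction generalizing v with
  | mem g hg =>
    obtain ⟨q | a, rfl⟩ := hg
    · refine ⟨_, ⟨FreeGroup.of (M.nextWord hM.2.1 q v), rfl⟩, ?_⟩
      have h1 : M.fundamentalAction hM (PresentedGroup.of (Sum.inl q)) = M.stateAut hM q := by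
        simp [fundamentalAction]
      rw [h1]
      have h := M.states_mul_letters hM q v
      rw [states, FreeGroup.lift_apply_of] at h
      exact h
    · refine ⟨1, one_mem _, ?_⟩
      have h1 : M.letters (FreeGroup.of a) = PresentedGroup.of (Sum.inr a) := by simp [letters]
      rw [← h1, fundamentalAction_letters, mul_one, ← map_mul]
      rfl
  | one => exact ⟨1, one_mem _, by simp⟩
  | mul g g' _ _ hg hg' =>
    obtain ⟨h', hh', e'⟩ := hg' v
    obtain ⟨h, hh, e⟩ := hg (M.fundamentalAction hM g' • v)
    refine ⟨h * h', mul_mem hh hh', ?_⟩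
    rw [mul_assoc, e', ← mul_assoc, e, map_mul, mul_smul, mul_assoc]
  | inv g _ hg =>
    obtain ⟨h, hh, e⟩ := hg (M.fundamentalAction hM g⁻¹ • v)
    refine ⟨h⁻¹, inv_mem hh, ?_⟩
    rw [map_inv, smul_inv_smul] at e
    rw [map_inv, eq_mul_inv_iff_mul_eq, mul_assoc, ← e, inv_mul_cancel_left]

/-- States fix the identity vertex. -/
theorem fundamentalAction_states_one (g : M.FundamentalGroup) (hg : g ∈ M.states.range) :
    M.fundamentalAction hM g • (1 : FreeGroup A) = 1 := by
  have h : M.states.range ≤ (MulAction.stabilizer (freeTree A).aut (1 : FreeGroup A)).comap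
      (M.fundamentalAction hM) := by
    refine FreeGroup.range_lift_le ?_
    rintro _ ⟨q, rfl⟩
    have h1 : M.fundamentalAction hM (PresentedGroup.of (Sum.inl q)) = M.stateAut hM q := by
      simp [fundamentalAction]
    rw [SetLike.mem_coe, Subgroup.mem_comap, h1]
    exact M.outWord_one hM.2.1 q
  exact h hg

theorem stateKernel_le_ker : M.stateKernel ≤ (M.fundamentalAction hM).ker := by
  intro g hg
  refine freeTree_aut_eq_one _ (fun v => ?_)
  have h := M.fundamentalAction_states_one hM _ (hg (M.letters v)⁻¹)
  have hv : M.fundamentalAction hM (M.letters v) • (1 : FreeGroup A) = v := by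
    rw [fundamentalAction_letters]
    exact mul_one v
  rw [inv_inv, map_mul, map_mul, map_inv, mul_smul, mul_smul, inv_smul_eq_iff, hv] at h
  exact h

/-- The homomorphism `ψ_M : π₁(M)/N_Q → Aut(T_A)` induced by `Ψ_M`. -/
noncomputable def quotientAction : M.FundamentalGroup ⧸ M.stateKernel →* (freeTree A).aut :=
  QuotientGroup.lift M.stateKernel (M.fundamentalAction hM) (M.stateKernel_le_ker hM)

end action

end MealyAutomaton

/-! ### Marked groups, the graph `X = ker φ \ T_A` and its bireversible automorphisms -/

section marked

variable {A : Type u} {G : Type v} [Group G] (φ : FreeGroup A →* G)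

/-- `ker φ`, as a group of automorphisms of `T_A` acting by left multiplication. -/
def kernelAut : Subgroup (freeTree A).aut := φ.ker.map (leftMul A)

/-- The vertex set of `X = ker φ \ T_A`. -/
abbrev MarkedVertex : Type u := MulAction.orbitRel.Quotient (kernelAut φ) (FreeGroup A)

/-- The edge set of `X = ker φ \ T_A`. -/
abbrev MarkedEdge : Type u := MulAction.orbitRel.Quotient (kernelAut φ) (FreeGroup A × A)

/-- The graph `X = ker φ \ T_A`. -/
def markedGraph : DirectedMultigraph (MarkedVertex φ) (MarkedEdge φ) :=
  (freeTree A).quotient (kernelAut φ)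

/-- The vertex of `X` that corresponds to the identity. -/
def baseVertex : MarkedVertex φ := Quotient.mk _ (1 : FreeGroup A)

/-- The homomorphism `ζ_φ` from the normaliser of `ker φ` in `Aut(T_A)` to `Aut(X)`. -/
def zeta : Subgroup.normalizer (kernelAut φ : Set (freeTree A).aut) →* (markedGraph φ).aut :=
  (freeTree A).descend (kernelAut φ)

theorem leftMul_mem_normalizer (g : FreeGroup A) :
    leftMul A g ∈ Subgroup.normalizer (kernelAut φ : Set (freeTree A).aut) := by
  have h : ∀ (g : FreeGroup A) (x : (freeTree A).aut), x ∈ kernelAut φ →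
      leftMul A g * x * (leftMul A g)⁻¹ ∈ kernelAut φ := by
    rintro g _ ⟨k, hk, rfl⟩
    exact ⟨g * k * g⁻¹, φ.normal_ker.conj_mem k hk g, by simp⟩
  refine Subgroup.mem_normalizer_iff.2 fun x => ⟨h g x, fun hx => ?_⟩
  have := h g⁻¹ _ hx
  rw [map_inv, inv_inv] at this
  simpa [mul_assoc] using this

/-- The action of `F_A` on `X` by left multiplication. -/
def freeAction : FreeGroup A →* (markedGraph φ).aut :=
  (zeta φ).comp ((leftMul A).codRestrict _ (leftMul_mem_normalizer φ))

theorem ker_le_ker_freeAction : φ.ker ≤ (freeAction φ).ker := by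
  intro k hk
  have hk' : leftMul A k ∈ kernelAut φ := ⟨k, hk, rfl⟩
  refine DirectedMultigraph.aut_ext _ (fun x => ?_) (fun e => ?_)
  · induction x using Quotient.inductionOn with
    | _ x => exact Quotient.sound ⟨⟨_, hk'⟩, rfl⟩
  · induction e using Quotient.inductionOn with
    | _ e => exact Quotient.sound ⟨⟨_, hk'⟩, rfl⟩

/-- The action of `G` on `X`: the element `φ(g)` acts by left multiplication by `g ∈ F_A`. -/
noncomputable def markedAction (hφ : Function.Surjective φ) : G →* (markedGraph φ).aut :=
  φ.liftOfSurjective hφ ⟨freeAction φ, ker_le_ker_freeAction φ⟩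

/-- `M` is compatible with the marking `φ` if (the image of) `ker φ` is normal in `π₁(M)/N_Q`. -/
def MealyAutomaton.Compatible {Q : Type w} (M : MealyAutomaton A Q) : Prop :=
  (φ.ker.map ((QuotientGroup.mk' M.stateKernel).comp M.letters)).Normal

/-- The bireversible automorphisms of `X`: those that fix the base vertex and lie in
`ζ_φ(ψ_M(G_M))` for some bireversible automaton `M` over the alphabet `A`, with a finite set of
states, that is compatible with `φ`. -/
def IsBireversibleAut (f : (markedGraph φ).aut) : Prop :=
  f ∈ MulAction.stabilizer (markedGraph φ).aut (baseVertex φ) ∧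
    ∃ (Q : Type) (_ : Finite Q) (M : MealyAutomaton A Q) (hM : M.Bireversible),
      M.Compatible φ ∧
      ∃ n : Subgroup.normalizer (kernelAut φ : Set (freeTree A).aut),
        (n : (freeTree A).aut) ∈ M.automatonGroup.map (M.quotientAction hM) ∧ zeta φ n = f

end marked

/-! ### Commensurators -/

namespace Subgroup

/-! Commensuration is measured inside the free group: for `c : B →* Γ`, the index of `conjComap c g`
in `B` is finite for both `g` and `g⁻¹` exactly when `g` commensurates the range of `c`.

A state satisfies q·v = λ_q(v)·ρ_v(q) in Aut(T_A). If u and v lead q to the same state, then q u v⁻¹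
q⁻¹ = λ_q(u) λ_q(v)⁻¹ lies in F_A; as there are finitely many states, q commensurates F_A
(`stateAut_mem_commensurator`). So does every product of states, and ζ transports this to X
(`zeta_mem_commensurator`).

Conversely, let f commensurate G and fix the base vertex, and let H be the finite-index subgroup of
u ∈ F_A with f u f⁻¹ ∈ G. As G preserves edge labels, the label of f(edge (u, a)) depends only on
the coset Hu and on a. The cosets are therefore the states of an automaton that records how f
changes labels; it is bireversible since f is injective and X has one incoming and one outgoing edge
per label at each vertex. Following paths shows that all states normalise ker φ, which gives
compatibility, and that the state of the trivial coset lifts f. -/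

/-- A subgroup has finite index as soon as its right cosets are separated by a map to a finite
set. -/
theorem index_ne_zero_of_map {B Q : Type*} [Group B] [Finite Q] (S : Subgroup B) (τ : B → Q)
    (h : ∀ u v, τ u = τ v → u * v⁻¹ ∈ S) : S.index ≠ 0 := by
  rw [index_ne_zero_iff_finite]
  -- `B ⧸ S` consists of left cosets, while `τ` separates right cosets; inversion exchanges them.
  refine Finite.of_injective (fun x : B ⧸ S => τ x.out⁻¹) (fun x y hxy => ?_)
  rw [← QuotientGroup.out_eq' x, ← QuotientGroup.out_eq' y, QuotientGroup.eq]
  simpa using h _ _ hxy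

/-- The elements of the source of `c` that stay in the range of `c` when conjugated by `g`. -/
def conjComap {B Γ : Type*} [Group B] [Group Γ] (c : B →* Γ) (g : Γ) : Subgroup B :=
  c.range.comap ((MulAut.conj g).toMonoidHom.comp c)

theorem mem_conjComap {B Γ : Type*} [Group B] [Group Γ] {c : B →* Γ} {g : Γ} {u : B} :
    u ∈ conjComap c g ↔ ∃ w, c w = g * c u * g⁻¹ := Iff.rfl

open scoped Pointwise in
theorem index_conjComap {B Γ : Type*} [Group B] [Group Γ] (c : B →* Γ) (g : Γ) :
    (conjComap c g).index = c.range.relIndex (ConjAct.toConjAct g • c.range) := by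
  rw [conjComap, index_comap, MonoidHom.range_comp]
  rfl

open scoped Pointwise in
theorem mem_commensurator_range_iff {B Γ : Type*} [Group B] [Group Γ] (c : B →* Γ) (g : Γ) :
    g ∈ Commensurable.commensurator c.range ↔
      (conjComap c g).index ≠ 0 ∧ (conjComap c g⁻¹).index ≠ 0 := by
  have key : ∀ g ∈ Commensurable.commensurator c.range, (conjComap c g).index ≠ 0 := by
    intro g hg
    rw [index_conjComap]
    exact ((Commensurable.commensurator_mem_iff _ _).1 hg).2
  refine ⟨fun h => ⟨key g h, key _ (inv_mem h)⟩, fun ⟨h1, h2⟩ => ?_⟩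
  rw [index_conjComap] at h1 h2
  refine (Commensurable.commensurator_mem_iff _ _).2 ⟨?_, h1⟩
  -- Conjugating both subgroups by `g⁻¹` turns the other half of commensurability for `g` into the
  -- index attached to `g⁻¹`.
  rw [← relIndex_pointwise_smul (ConjAct.toConjAct g⁻¹), smul_smul, ← ConjAct.toConjAct_mul]
  simpa using h2

end Subgroup

/-! ### States commensurate the free group -/

namespace MealyAutomaton

variable {A : Type u} {Q : Type v} (M : MealyAutomaton A Q) (hM : M.Bireversible)

theorem fundamentalAction_state (q : Q) :
    M.fundamentalAction hM (M.states (FreeGroup.of q)) = M.stateAut hM q := by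
  simp [fundamentalAction, states]

/-- Image of `states_mul_letters` in Aut(T_A), where the index computations take place. -/
theorem stateAut_mul_leftMul (q : Q) (v : FreeGroup A) :
    M.stateAut hM q * leftMul A v =
      leftMul A (M.outWord hM.2.1 q v) * M.stateAut hM (M.nextWord hM.2.1 q v) := by
  have h := congrArg (M.fundamentalAction hM) (M.states_mul_letters hM q v)
  simpa only [map_mul, fundamentalAction_state, fundamentalAction_letters] using h

theorem stateAut_mem_commensurator [Finite Q] (q : Q) :
    M.stateAut hM q ∈ Subgroup.Commensurable.commensurator (leftMul A).range := by
  rw [Subgroup.mem_commensurator_range_iff]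
  set p := M.stateAut hM q with hp
  have hfwd := M.stateAut_mul_leftMul hM q
  rw [← hp] at hfwd
  constructor
  · refine Subgroup.index_ne_zero_of_map _ (M.nextWord hM.2.1 q) (fun u v huv => ?_)
    refine Subgroup.mem_conjComap.2
      ⟨M.outWord hM.2.1 q u * (M.outWord hM.2.1 q v)⁻¹, ?_⟩
    have hu := hfwd u
    rw [huv] at hu
    rw [map_mul, map_inv, map_mul, map_inv, eq_mul_inv_of_mul_eq hu.symm,
      eq_mul_inv_of_mul_eq (hfwd v).symm]
    group
  -- For `q⁻¹`, write u = λ_q(x u): then q·(x u) = u·p, where p is the state reached after x u.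
  -- Equal p for u and v gives q⁻¹ u v⁻¹ q = (x u)(x v)⁻¹.
  · let x : FreeGroup A → FreeGroup A :=
      (M.inverse hM.1).outWord (M.inverse_reversible hM) q
    have hx : ∀ u, M.outWord hM.2.1 q (x u) = u := fun u => (M.words_inverse_words hM q u).1
    refine Subgroup.index_ne_zero_of_map _ (fun u => M.nextWord hM.2.1 q (x u))
      (fun u v huv => ?_)
    refine Subgroup.mem_conjComap.2 ⟨x u * (x v)⁻¹, ?_⟩
    have hu := hfwd (x u)
    have hv := hfwd (x v)
    rw [huv, hx] at hu
    rw [hx] at hv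
    rw [map_mul, map_inv, map_mul, map_inv, eq_inv_mul_of_mul_eq hu, eq_inv_mul_of_mul_eq hv]
    group

theorem map_automatonGroup_le_commensurator [Finite Q] :
    M.automatonGroup.map (M.quotientAction hM) ≤
      Subgroup.Commensurable.commensurator (leftMul A).range := by
  rintro _ ⟨_, ⟨_, ⟨h, rfl⟩, rfl⟩, rfl⟩
  change M.fundamentalAction hM (M.states h) ∈ _
  induction h using FreeGroup.induction_on with
  | C1 => simp only [map_one, one_mem]
  | of q =>
    rw [fundamentalAction_state]
    exact M.stateAut_mem_commensurator hM q
  | inv_of q h => simpa only [map_inv] using inv_mem h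
  | mul x y hx hy => simpa only [map_mul] using mul_mem hx hy

/-- The fundamental group modulo `N_Q` acts faithfully on the tree. -/
theorem ker_fundamentalAction_le : (M.fundamentalAction hM).ker ≤ M.stateKernel := by
  refine (Subgroup.normal_le_normalCore).2 (fun g hg => ?_)
  -- An element fixing the vertex 1 lies in F_Q, and the kernel is normal, hence contained in the
  -- normal core.
  obtain ⟨h, hh, e⟩ := M.fundamentalAction_spec hM g 1
  rw [MonoidHom.mem_ker.1 hg, one_smul, map_one, mul_one, one_mul] at e
  rwa [e]

/-- An automaton is compatible with a marking whose kernel is normalised by all its states. -/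
theorem compatible_of_stateAut_mem_normalizer {G : Type*} [Group G] (φ : FreeGroup A →* G)
    (h : ∀ q, M.stateAut hM q ∈ Subgroup.normalizer (kernelAut φ : Set (freeTree A).aut)) :
    M.Compatible φ := by
  have hall : ∀ g : M.FundamentalGroup,
      M.fundamentalAction hM g ∈ Subgroup.normalizer (kernelAut φ : Set (freeTree A).aut) := by
    intro g
    have hg : g ∈ Subgroup.closure (Set.range (PresentedGroup.of (rels := M.relators))) := by
      rw [PresentedGroup.closure_range_of]; trivial
    induction hg using Subgroup.closure_induction with
    | mem g hg =>
      obtain ⟨q | a, rfl⟩ := hg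
      · simpa [fundamentalAction] using h q
      · simpa [fundamentalAction] using leftMul_mem_normalizer φ (FreeGroup.of a)
    | one => simp only [map_one, one_mem]
    | mul x y _ _ hx hy => simpa only [map_mul] using mul_mem hx hy
    | inv x _ hx => simpa only [map_inv] using inv_mem hx
  refine ⟨?_⟩
  rintro _ ⟨k, hk, rfl⟩ g
  induction g using QuotientGroup.induction_on with
  | H g =>
    obtain ⟨k', hk', e⟩ := (Subgroup.mem_normalizer_iff.1 (hall g) (leftMul A k)).1 ⟨k, hk, rfl⟩
    -- By faithfulness, the conjugation identity need only be checked in Aut(T_A).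
    refine ⟨k', hk', QuotientGroup.eq.2 (M.ker_fundamentalAction_le hM ?_)⟩
    rw [← M.fundamentalAction_letters hM, ← M.fundamentalAction_letters hM k] at e
    rw [MonoidHom.mem_ker, map_mul, map_inv, e]
    simp [mul_assoc]

end MealyAutomaton

/-! ### The graph `X` -/

section marked

variable {A : Type u} {G : Type v} [Group G] (φ : FreeGroup A →* G)

/-- Lets every index be counted in F_A instead of G. -/
theorem range_markedAction (hφ : Function.Surjective φ) :
    (markedAction φ hφ).range = (freeAction φ).range := by
  have h : ∀ u, markedAction φ hφ (φ u) = freeAction φ u := fun u =>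
    MonoidHom.liftOfRightInverse_comp_apply _ _ _ _ u
  ext f
  constructor
  · rintro ⟨g, rfl⟩
    obtain ⟨u, rfl⟩ := hφ g
    exact ⟨u, (h u).symm⟩
  · rintro ⟨u, rfl⟩
    exact ⟨φ u, h u⟩

/-- The image of a commensurating element under `ζ` is commensurating. -/
theorem zeta_mem_commensurator (n : Subgroup.normalizer (kernelAut φ : Set (freeTree A).aut))
    (hn : (n : (freeTree A).aut) ∈ Subgroup.Commensurable.commensurator (leftMul A).range) :
    zeta φ n ∈ Subgroup.Commensurable.commensurator (freeAction φ).range := by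
  -- ζ intertwines the two actions of F_A, so passing to X can only enlarge the subgroup; its index
  -- then divides a finite one.
  have key : ∀ n : Subgroup.normalizer (kernelAut φ : Set (freeTree A).aut),
      Subgroup.conjComap (leftMul A) n ≤ Subgroup.conjComap (freeAction φ) (zeta φ n) := by
    intro n u hu
    obtain ⟨w, hw⟩ := Subgroup.mem_conjComap.1 hu
    refine Subgroup.mem_conjComap.2 ⟨w, ?_⟩
    change zeta φ ⟨leftMul A w, _⟩ = zeta φ n * zeta φ ⟨leftMul A u, _⟩ * (zeta φ n)⁻¹
    rw [← map_inv, ← map_mul, ← map_mul]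
    exact congrArg _ (Subtype.ext hw)
  rw [Subgroup.mem_commensurator_range_iff] at hn ⊢
  refine ⟨ne_zero_of_dvd_ne_zero hn.1 (Subgroup.index_dvd_of_le (key n)),
    ne_zero_of_dvd_ne_zero hn.2 (Subgroup.index_dvd_of_le ?_)⟩
  rw [← map_inv]
  exact key n⁻¹

/-! ### Coordinates on X: vertices as elements of G, edges as pairs (element of G, label) -/

/-- The vertex of `X` below a vertex of the tree. -/
def vertexClass (x : FreeGroup A) : MarkedVertex φ := Quotient.mk _ x

/-- The edge of `X` below an edge of the tree. -/
def edgeClass (x : FreeGroup A) (a : A) : MarkedEdge φ := Quotient.mk _ (x, a)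

theorem vertexClass_eq_iff {x y : FreeGroup A} :
    vertexClass φ x = vertexClass φ y ↔ φ x = φ y := by
  refine Quotient.eq.trans ⟨?_, fun h => ?_⟩
  · rintro ⟨⟨_, k, hk, rfl⟩, rfl⟩
    change φ (k * y) = φ y
    rw [map_mul, MonoidHom.mem_ker.1 hk, one_mul]
  · refine ⟨⟨_, x * y⁻¹, ?_, rfl⟩, inv_mul_cancel_right x y⟩
    simp [h]

theorem edgeClass_eq_iff {x y : FreeGroup A} {a b : A} :
    edgeClass φ x a = edgeClass φ y b ↔ φ x = φ y ∧ a = b := by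
  refine Quotient.eq.trans ⟨?_, fun ⟨h, hab⟩ => ?_⟩
  · rintro ⟨⟨_, k, hk, rfl⟩, h⟩
    have h1 : k * y = x := congrArg Prod.fst h
    have h2 : b = a := congrArg Prod.snd h
    refine ⟨?_, h2.symm⟩
    rw [← h1, map_mul, MonoidHom.mem_ker.1 hk, one_mul]
  · refine ⟨⟨_, x * y⁻¹, ?_, rfl⟩, Prod.ext (inv_mul_cancel_right x y) hab.symm⟩
    simp [h]

theorem exists_vertexClass (x : MarkedVertex φ) : ∃ v, vertexClass φ v = x :=
  Quotient.exists_rep x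

theorem exists_edgeClass (e : MarkedEdge φ) : ∃ x a, edgeClass φ x a = e := by
  obtain ⟨⟨x, a⟩, h⟩ := Quotient.exists_rep e
  exact ⟨x, a, h⟩

theorem src_edgeClass (x : FreeGroup A) (a : A) :
    (markedGraph φ).src (edgeClass φ x a) = vertexClass φ x := rfl

theorem tgt_edgeClass (x : FreeGroup A) (a : A) :
    (markedGraph φ).tgt (edgeClass φ x a) = vertexClass φ (x * FreeGroup.of a) := rfl

theorem freeAction_smul_edgeClass (u x : FreeGroup A) (a : A) :
    freeAction φ u • edgeClass φ x a = edgeClass φ (u * x) a := rfl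

/-- The label of an edge of `X`. -/
def edgeLabel : MarkedEdge φ → A :=
  Quotient.lift Prod.snd (by
    rintro e e' ⟨⟨_, k, hk, rfl⟩, h⟩
    exact (congrArg Prod.snd h).symm)

@[simp] theorem edgeLabel_edgeClass (x : FreeGroup A) (a : A) :
    edgeLabel φ (edgeClass φ x a) = a := rfl

theorem edgeLabel_freeAction (u : FreeGroup A) (e : MarkedEdge φ) :
    edgeLabel φ (freeAction φ u • e) = edgeLabel φ e := by
  obtain ⟨x, a, rfl⟩ := exists_edgeClass φ e
  rfl

/-- Determinism of X; with its mirror image `edge_ext_tgt`, it is what makes the coset automaton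
bireversible. -/
theorem edge_ext_src {e e' : MarkedEdge φ}
    (h : (markedGraph φ).src e = (markedGraph φ).src e') (hl : edgeLabel φ e = edgeLabel φ e') :
    e = e' := by
  obtain ⟨x, a, rfl⟩ := exists_edgeClass φ e
  obtain ⟨y, b, rfl⟩ := exists_edgeClass φ e'
  exact (edgeClass_eq_iff φ).2 ⟨(vertexClass_eq_iff φ).1 h, hl⟩

theorem edge_ext_tgt {e e' : MarkedEdge φ}
    (h : (markedGraph φ).tgt e = (markedGraph φ).tgt e') (hl : edgeLabel φ e = edgeLabel φ e') :
    e = e' := by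
  obtain ⟨x, a, rfl⟩ := exists_edgeClass φ e
  obtain ⟨y, b, rfl⟩ := exists_edgeClass φ e'
  obtain rfl : a = b := hl
  have h' : φ (x * FreeGroup.of a) = φ (y * FreeGroup.of a) := (vertexClass_eq_iff φ).1 h
  rw [map_mul, map_mul, mul_left_inj] at h'
  exact (edgeClass_eq_iff φ).2 ⟨h', rfl⟩

theorem smul_edgeClass (f : (markedGraph φ).aut) {x w : FreeGroup A}
    (h : f • vertexClass φ x = vertexClass φ w) (a : A) :
    f • edgeClass φ x a = edgeClass φ w (edgeLabel φ (f • edgeClass φ x a)) := by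
  refine edge_ext_src φ ?_ rfl
  rw [DirectedMultigraph.src_smul]
  exact h

/-! ### The automaton of a commensurating automorphism -/

/-- Edges of `X` with the same label whose origins differ by an element of `G ∩ f⁻¹ G f` are mapped
by `f` to edges with the same label. -/
theorem edgeLabel_smul_eq (f : (markedGraph φ).aut) {u v : FreeGroup A}
    (h : u * v⁻¹ ∈ Subgroup.conjComap (freeAction φ) f) (a : A) :
    edgeLabel φ (f • edgeClass φ u a) = edgeLabel φ (f • edgeClass φ v a) := by
  obtain ⟨w, hw⟩ := Subgroup.mem_conjComap.1 h
  have h1 : edgeClass φ u a = freeAction φ (u * v⁻¹) • edgeClass φ v a := by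
    rw [freeAction_smul_edgeClass, inv_mul_cancel_right]
  -- Moves f past u v⁻¹, which becomes the label-preserving action of `w`.
  rw [h1, smul_smul, ← mul_inv_eq_iff_eq_mul.1 hw.symm |>.symm, mul_smul, edgeLabel_freeAction]

/-- The automaton describing an automorphism `f` of `X`, with states the right cosets of the
commensurating subgroup of `f`, indexed by `Q`: the coset of `u` is `σ u`, and `r q` represents
the coset `q`. -/
def cosetAutomaton {Q : Type w} (f : (markedGraph φ).aut) (σ : FreeGroup A → Q)
    (r : Q → FreeGroup A) : MealyAutomaton A Q where
  out q a := edgeLabel φ (f • edgeClass φ (r q) a)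
  next q a := σ (r q * FreeGroup.of a)

section coset

variable {Q : Type w} (f : (markedGraph φ).aut) (σ : FreeGroup A → Q) (r : Q → FreeGroup A)
  (hr : ∀ q, σ (r q) = q)
  (hσ : ∀ u v, σ u = σ v ↔ u * v⁻¹ ∈ Subgroup.conjComap (freeAction φ) f)

include hr hσ

theorem cosetAutomaton_out (u : FreeGroup A) (a : A) :
    (cosetAutomaton φ f σ r).out (σ u) a = edgeLabel φ (f • edgeClass φ u a) :=
  edgeLabel_smul_eq φ f ((hσ _ _).1 (hr _)) a

theorem cosetAutomaton_next (u : FreeGroup A) (a : A) :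
    (cosetAutomaton φ f σ r).next (σ u) a = σ (u * FreeGroup.of a) := by
  refine (hσ _ _).2 ?_
  have := (hσ _ _).1 (hr (σ u))
  simpa [mul_assoc] using this

/-- By finiteness, injectivity suffices: for outputs it comes from `edge_ext_src`, for transitions
from cancelling a on the right, and for the joint map from `edge_ext_tgt`. -/
theorem cosetAutomaton_bireversible [Finite A] [Finite Q] :
    (cosetAutomaton φ f σ r).Bireversible := by
  have hout := cosetAutomaton_out φ f σ r hr hσ
  have hnext := cosetAutomaton_next φ f σ r hr hσ
  refine ⟨fun q => Function.Injective.bijective_of_finite ?_,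
    fun a => Function.Injective.bijective_of_finite ?_,
    Function.Injective.bijective_of_nat_card_le ?_ (by simp [mul_comm])⟩
  · intro a b h
    have h1 := edge_ext_src φ (e := f • edgeClass φ (r q) a) (e' := f • edgeClass φ (r q) b)
      (by simp only [DirectedMultigraph.src_smul, src_edgeClass]) h
    exact ((edgeClass_eq_iff φ).1 (MulAction.injective f h1)).2
  · intro p q h
    rw [← hr p, ← hr q, hσ]
    simpa [mul_assoc] using (hσ _ _).1 h
  · rintro ⟨p, a⟩ ⟨q, b⟩ h
    rw [← hr p, ← hr q] at h ⊢
    generalize r p = u at *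
    generalize r q = v at *
    obtain ⟨h1, h2⟩ := Prod.ext_iff.1 h
    dsimp only at h1 h2
    rw [hnext, hnext, hσ] at h2
    -- Replaces v by the representative u a b⁻¹ of its coset, so that the edges labelled a from u
    -- and b from u a b⁻¹ end at the same vertex.
    have hv : σ (u * FreeGroup.of a * (FreeGroup.of b)⁻¹) = σ v := by
      rw [hσ]
      simpa [mul_assoc] using h2
    rw [← hv, hout, hout] at h1
    have he := edge_ext_tgt φ (e := f • edgeClass φ u a)
      (e' := f • edgeClass φ (u * FreeGroup.of a * (FreeGroup.of b)⁻¹) b)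
      (by simp only [DirectedMultigraph.tgt_smul, tgt_edgeClass, inv_mul_cancel_right]) h1
    obtain rfl := ((edgeClass_eq_iff φ).1 (MulAction.injective f he)).2
    rw [← hv, mul_inv_cancel_right]

/-! ### The coset automaton on group words -/

variable (hM : (cosetAutomaton φ f σ r).Reversible)

theorem cosetAutomaton_nextWord (u v : FreeGroup A) :
    (cosetAutomaton φ f σ r).nextWord hM (σ u) v = σ (u * v) := by
  induction v using FreeGroup.induction_on generalizing u with
  | C1 => simp
  | of a => rw [MealyAutomaton.nextWord_of, cosetAutomaton_next φ f σ r hr hσ]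
  | inv_of a ih =>
    have h := ih (u * (FreeGroup.of a)⁻¹)
    rw [inv_mul_cancel_right] at h
    rw [← h, ← MealyAutomaton.nextWord_mul, mul_inv_cancel, MealyAutomaton.nextWord_one]
  | mul v w hv hw => rw [MealyAutomaton.nextWord_mul, hv, hw, mul_assoc]

/-- f carries the path labelled v from u to the path from w labelled by the automaton's output. The
transition at each letter supplies the coset needed for the next label. -/
theorem smul_vertexClass_mul (u v w : FreeGroup A) (h : f • vertexClass φ u = vertexClass φ w) :
    f • vertexClass φ (u * v) =
      vertexClass φ (w * (cosetAutomaton φ f σ r).outWord hM (σ u) v) := by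
  induction v using FreeGroup.induction_on generalizing u w with
  | C1 => simpa using h
  | of a =>
    rw [MealyAutomaton.outWord_of, cosetAutomaton_out φ f σ r hr hσ, ← tgt_edgeClass,
      ← tgt_edgeClass, ← DirectedMultigraph.tgt_smul, ← smul_edgeClass φ f h]
  | inv_of a ih =>
    set x := FreeGroup.of a
    -- For an inverse letter, name the unknown image of u x⁻¹ and apply the forward case from there
    -- back to u.
    obtain ⟨w', hw'⟩ := exists_vertexClass φ (f • vertexClass φ (u * x⁻¹))
    have h1 := ih _ _ hw'.symm
    rw [inv_mul_cancel_right, h, vertexClass_eq_iff] at h1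
    have h2 := (cosetAutomaton φ f σ r).outWord_mul hM (σ u) x⁻¹ x
    rw [inv_mul_cancel, MealyAutomaton.outWord_one,
      cosetAutomaton_nextWord φ f σ r hr hσ hM] at h2
    rw [← hw', vertexClass_eq_iff, map_mul, h1, eq_inv_of_mul_eq_one_left h2.symm]
    simp
  | mul v v' hv hv' =>
    rw [← mul_assoc, hv' _ _ (hv _ _ h), MealyAutomaton.outWord_mul,
      cosetAutomaton_nextWord φ f σ r hr hσ hM, mul_assoc]

/-- A word lies in ker φ exactly when it labels a closed path in X, and f both preserves and
reflects closed paths. -/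
theorem cosetAutomaton_outWord_mem_ker_iff (q : Q) (k : FreeGroup A) :
    (cosetAutomaton φ f σ r).outWord hM q k ∈ φ.ker ↔ k ∈ φ.ker := by
  obtain ⟨w, hw⟩ := exists_vertexClass φ (f • vertexClass φ (r q))
  have h := smul_vertexClass_mul φ f σ r hr hσ hM (r q) k w hw.symm
  rw [hr] at h
  constructor <;> intro hk
  · have h1 : vertexClass φ (w * (cosetAutomaton φ f σ r).outWord hM q k) = vertexClass φ w := by
      rw [vertexClass_eq_iff, map_mul, MonoidHom.mem_ker.1 hk, mul_one]
    rw [h1, hw, smul_left_cancel_iff, vertexClass_eq_iff, map_mul] at h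
    simpa using h
  · have h1 : vertexClass φ (r q * k) = vertexClass φ (r q) := by
      rw [vertexClass_eq_iff, map_mul, MonoidHom.mem_ker.1 hk, mul_one]
    rw [h1, ← hw, vertexClass_eq_iff, map_mul] at h
    simpa using h

/-- ker φ is normal and acts trivially on X, so its conjugates lie in the commensurating subgroup
and reading k does not change the coset. -/
theorem cosetAutomaton_nextWord_of_mem_ker (q : Q) {k : FreeGroup A} (hk : k ∈ φ.ker) :
    (cosetAutomaton φ f σ r).nextWord hM q k = q := by
  have h := cosetAutomaton_nextWord φ f σ r hr hσ hM (r q) k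
  rw [hr] at h
  rw [h]
  conv_rhs => rw [← hr q]
  refine (hσ _ _).2 (Subgroup.mem_conjComap.2 ⟨1, ?_⟩)
  have h1 : r q * k * (r q)⁻¹ ∈ φ.ker := φ.normal_ker.conj_mem k hk _
  rw [MonoidHom.mem_ker.1 (ker_le_ker_freeAction φ h1)]
  simp

/-- Since k ∈ ker φ returns q to itself, the exchange relation becomes q k q⁻¹ = λ_q(k), which is
again in ker φ. -/
theorem cosetAutomaton_stateAut_mem_normalizer (hB : (cosetAutomaton φ f σ r).Bireversible)
    (q : Q) : (cosetAutomaton φ f σ r).stateAut hB q ∈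
      Subgroup.normalizer (kernelAut φ : Set (freeTree A).aut) := by
  have key : ∀ k ∈ φ.ker, (cosetAutomaton φ f σ r).stateAut hB q * leftMul A k *
      ((cosetAutomaton φ f σ r).stateAut hB q)⁻¹ =
        leftMul A ((cosetAutomaton φ f σ r).outWord hB.2.1 q k) := by
    intro k hk
    rw [MealyAutomaton.stateAut_mul_leftMul, mul_inv_eq_iff_eq_mul,
      cosetAutomaton_nextWord_of_mem_ker φ f σ r hr hσ _ q hk]
  have hker := cosetAutomaton_outWord_mem_ker_iff φ f σ r hr hσ hB.2.1 q
  refine Subgroup.mem_normalizer_iff.2 fun x => ⟨?_, ?_⟩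
  · rintro ⟨k, hk, rfl⟩
    rw [key k hk]
    exact ⟨_, (hker k).2 hk, rfl⟩
  · rintro ⟨k, hk, e⟩
    -- The inverse automaton yields the λ_q-preimage of k, which lies in ker φ by the equivalence
    -- `hker`.
    set k' := ((cosetAutomaton φ f σ r).inverse hB.1).outWord (MealyAutomaton.inverse_reversible _ hB) q k
    have hk' : (cosetAutomaton φ f σ r).outWord hB.2.1 q k' = k := ((cosetAutomaton φ f σ r).words_inverse_words hB q k).1
    have hk'' : k' ∈ φ.ker := by
      rw [← hker k']
      exact hk'.symm ▸ hk
    refine ⟨k', hk'', ?_⟩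
    rw [← hk', ← key k' hk''] at e
    simpa using e

/-- The state of the trivial coset is a lift of `f` to the tree. -/
theorem zeta_cosetAutomaton_stateAut (hB : (cosetAutomaton φ f σ r).Bireversible)
    (hf : f • baseVertex φ = baseVertex φ) :
    zeta φ ⟨_, cosetAutomaton_stateAut_mem_normalizer φ f σ r hr hσ hB (σ 1)⟩ = f := by
  have hV : ∀ v, f • vertexClass φ v =
      vertexClass φ ((cosetAutomaton φ f σ r).outWord hB.2.1 (σ 1) v) := by
    intro v
    simpa using smul_vertexClass_mul φ f σ r hr hσ hB.2.1 1 v 1 hf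
  refine DirectedMultigraph.aut_ext _ (fun x => ?_) (fun e => ?_)
  · obtain ⟨v, rfl⟩ := exists_vertexClass φ x
    exact (hV v).symm
  · obtain ⟨v, a, rfl⟩ := exists_edgeClass φ e
    rw [smul_edgeClass φ f (hV v), ← cosetAutomaton_out φ f σ r hr hσ,
      -- Exhibits σ v as the state reached from σ 1 after v, the form in which `stateAut` acts on
      -- edges.
      ← one_mul v, ← cosetAutomaton_nextWord φ f σ r hr hσ hB.2.1, one_mul]
    rfl

end coset

/-- Automorphisms fixing the base vertex and commensurating `G` are bireversible. -/
theorem isBireversibleAut_of_mem_commensurator [Finite A] (f : (markedGraph φ).aut)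
    (hf : f • baseVertex φ = baseVertex φ)
    (hc : f ∈ Subgroup.Commensurable.commensurator (freeAction φ).range) :
    IsBireversibleAut φ f := by
  set H := Subgroup.conjComap (freeAction φ) f with hH
  have hfin : Finite (FreeGroup A ⧸ H) :=
    Subgroup.index_ne_zero_iff_finite.1 ((Subgroup.mem_commensurator_range_iff _ _).1 hc).1
  -- States must form a set in `Type`, so cosets are numbered; the inverses in `σ` and `r` turn left
  -- cosets into right ones.
  let ε : FreeGroup A ⧸ H ≃ Fin (Nat.card (FreeGroup A ⧸ H)) := Finite.equivFin _
  let σ : FreeGroup A → Fin (Nat.card (FreeGroup A ⧸ H)) := fun u => ε (u⁻¹ : FreeGroup A)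
  let r : Fin (Nat.card (FreeGroup A ⧸ H)) → FreeGroup A := fun q => (ε.symm q).out⁻¹
  have hr : ∀ q, σ (r q) = q := by
    intro q
    simp [σ, r]
  have hσ : ∀ u v, σ u = σ v ↔ u * v⁻¹ ∈ H := by
    intro u v
    rw [ε.apply_eq_iff_eq, QuotientGroup.eq, inv_inv]
  have hB := cosetAutomaton_bireversible φ f σ r hr hσ
  have hN := cosetAutomaton_stateAut_mem_normalizer φ f σ r hr hσ hB
  refine ⟨hf, _, inferInstance, cosetAutomaton φ f σ r, hB,
    MealyAutomaton.compatible_of_stateAut_mem_normalizer _ hB φ hN, ⟨_, hN (σ 1)⟩, ?_,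
    zeta_cosetAutomaton_stateAut φ f σ r hr hσ hB hf⟩
  refine ⟨_, ⟨_, ⟨FreeGroup.of (σ 1), rfl⟩, rfl⟩, ?_⟩
  exact MealyAutomaton.fundamentalAction_state _ hB _

end marked

theorem mainTheorem3 {A : Type u} [Finite A] {G : Type v} [Group G]
    (φ : FreeGroup A →* G) (hφ : Function.Surjective φ) :
    ((Subgroup.Commensurable.commensurator (markedAction φ hφ).range ⊓
        MulAction.stabilizer (markedGraph φ).aut (baseVertex φ) :
          Subgroup (markedGraph φ).aut) : Set (markedGraph φ).aut) =
      {f | IsBireversibleAut φ f} := by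
  rw [range_markedAction]
  ext f
  constructor
  · rintro ⟨hc, hf⟩
    exact isBireversibleAut_of_mem_commensurator φ f hf hc
  · rintro ⟨hf, Q, _, M, hM, -, n, hn, rfl⟩
    exact ⟨zeta_mem_commensurator φ n (M.map_automatonGroup_le_commensurator hM hn), hf⟩
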